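/- There are absolute constants $k_1,k_2>0$ such that the following holds. Let $m\ge 1$, $\epsilon\in(0,4]$ and $\delta\in(0,1)$. There are a sample size $c\in\mathbb N$ with $$k_1\,\frac{m+\log(m/\delta)}{\epsilon^2}\;\le\; c\;\le\; k_2\,\frac{m+\log(m/\delta)}{\epsilon^2}$$ (that is, $c=\Theta((m+\log(m/\delta))/\epsilon^2)$) and a deterministic mechanism $f$, which maps a collection (multiset) of rankings of the $m$ candidates to a candidate, such that for every number $n\ge1$ of voters and all rankings $\sigma_1,\dots,\sigma_n$ of the $m$ candidates by these voters: if $c$ voters are sampled uniformly at random with replacement, or, provided that $c\le n$, uniformly at random without replacement, and $f$ is applied to the full rankings of the sampled voters only, then with probability at least $1-\delta$ the selected candidate $w$ has distortion at most $3+\epsilon$ with respect to all $n$ voters. Here the distortion of a candidate $w$ under $\sigma=(\sigma_1,\dots,\sigma_n)$ is $$\sup \frac{\sum_{i=1}^n d(v_i,c_w)}{\min_{a}\sum_{i=1}^n d(v_i,c_a)},$$ where the minimum is over all candidates $a$ and the supremum is over all metric spaces $(\mathcal M,d)$ and all points $v_1,\dots,v_n\in\mathcal M$ (voters) and $c_a\in\mathcal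 M$ (candidates) that are consistent with $\sigma$: whenever voter $i$ ranks $a$ before $b$, $d(v_i,c_a)\le d(v_i,c_b)$. (A ratio $x/0$ with $x>0$ is $\infty$; a ratio $0/0$ is disregarded.) -/

import Mathlib

universe u

namespace MetricVoting

/-- A ranking (total order) of the `m` candidates, given by the position of each candidate;
position `0` is the best one. -/
abbrev Ranking (m : ℕ) : Type := Fin m ≃ Fin m

/-- `σ.prefers a b`: the ranking `σ` places candidate `a` strictly before candidate `b`. -/
def Ranking.prefers {m : ℕ} (σ : Ranking m) (a b : Fin m) : Prop := σ a < σ b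

/-- The full preferences of `n` voters over `m` candidates. -/
abbrev Profile (n m : ℕ) : Type := Fin n → Ranking m

/-- Voters located at the points `v i` and candidates located at the points `c a` of a metric space
are consistent with the profile `P` if `a ≻ᵢ b` implies `d(vᵢ, c_a) ≤ d(vᵢ, c_b)`. -/
def Consistent {n m : ℕ} (P : Profile n m) {M : Type u} [MetricSpace M]
    (v : Fin n → M) (c : Fin m → M) : Prop :=
  ∀ (i : Fin n) (a b : Fin m), Ranking.prefers (P i) a b → dist (v i) (c a) ≤ dist (v i) (c b)

/-- The social cost of candidate `x`: the sum of its distances from all voters. -/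
noncomputable def socialCost {n m : ℕ} {M : Type u} [MetricSpace M]
    (v : Fin n → M) (c : Fin m → M) (x : Fin m) : ℝ :=
  ∑ i, dist (v i) (c x)

/-- The distortion of candidate `w` under the preferences `P`: the supremum of
`SC(w) / min_a SC(a)` over all metric spaces, and all locations of the voters and the candidates
in them, that are consistent with `P`. The ratio lives in `[0, ∞]`: it is `∞` if the optimal cost
is `0` and that of `w` is not, and it is harmless (`0`) if both are `0`. -/
noncomputable def distortion {n m : ℕ} (P : Profile n m) (w : Fin m) : ENNReal :=
  ⨆ (M : Type u) (_ : MetricSpace M) (v : Fin n → M) (c : Fin m → M) (_ : Consistent P v c),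
    ENNReal.ofReal (socialCost v c w) / ENNReal.ofReal (⨅ a, socialCost v c a)

/-- The law of `c` independent uniform draws from `n` voters (sampling with replacement). -/
noncomputable def withReplacement (c n : ℕ) : MeasureTheory.Measure (Fin c → Fin n) :=
  ProbabilityTheory.uniformOn Set.univ

/-- The law of a uniformly random sequence of `c` distinct voters among `n`
(sampling without replacement); a probability measure whenever `c ≤ n`. -/
noncomputable def withoutReplacement (c n : ℕ) : MeasureTheory.Measure (Fin c → Fin n) :=
  ProbabilityTheory.uniformOn {s | Function.Injective s}

/-- A deterministic mechanism: it sees only a collection of full rankings (counted with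
multiplicity, without the identities of the voters) and returns a candidate. -/
abbrev Mechanism (m : ℕ) : Type := Multiset (Ranking m) → Fin m

/-- The collection of the rankings of the sampled voters `s 0, …, s (c - 1)`. -/
def sampledRankings {c n m : ℕ} (P : Profile n m) (s : Fin c → Fin n) : Multiset (Ranking m) :=
  (Finset.univ : Finset (Fin c)).val.map fun k => P (s k)

/-- The event that the candidate which the mechanism `f` selects from the sampled rankings has
distortion at most `ℓ` with respect to the whole electorate. -/
def goodSamples {n m : ℕ} (c : ℕ) (P : Profile n m) (f : Mechanism m) (ℓ : ℝ) :
    Set (Fin c → Fin n) :=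
  {s | distortion.{u} P (f (sampledRankings P s)) ≤ ENNReal.ofReal ℓ}

end MetricVoting

/-! Run on the sample, plurality veto yields a candidate w whose total `gap w T` over the sample is
non-positive for every set T (`exists_veto_winner`). Gaps are bounded by 1 and there are only m·2^m
pairs (w, T). Hoeffding's bound and a union bound therefore make it unlikely that any pair with
average gap above η = ε/8 in the electorate has a non-positive sample sum. The union over all w
absorbs the dependence of the winner on the sample. Sampling without replacement obeys the same
exponential moment bound (`sum_exp_sum_injective_le`).

Gaps control Hall's condition for the graph joining voter j to the voters who weakly prefer w to the
top candidate of j. Average gaps at most η thus give a matching that misses at most ηn voters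
(`exists_injective_of_sum_gap_le`). A perfect matching gives distortion 3 by the triangle
inequality; the missed voters add at most 8η (`socialCost_le_of_injective`). -/

namespace MetricVoting

open Finset

/-! ### Concentration for sampling with and without replacement -/

/-- A sum of exponentials of centred bounded numbers is at most that of the subgaussian bound. -/
theorem _root_.Finset.sum_exp_le_of_sum_eq_zero {α : Type*} (A : Finset α) (y : α → ℝ) (B : ℝ)
    (hy : ∀ a ∈ A, |y a| ≤ B) (h0 : ∑ a ∈ A, y a = 0) :
    ∑ a ∈ A, Real.exp (y a) ≤ #A * Real.exp (B ^ 2 / 2) := by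
  rcases A.eq_empty_or_nonempty with rfl | ⟨a₀, ha₀⟩
  · simp
  have hB : 0 ≤ B := (abs_nonneg _).trans (hy a₀ ha₀)
  rcases hB.eq_or_lt with rfl | hB
  · have : ∀ a ∈ A, Real.exp (y a) = 1 := fun a ha => by
      rw [abs_nonpos_iff.1 (hy a ha), Real.exp_zero]
    rw [sum_congr rfl this]
    simp
  -- By convexity, `exp` lies below its chord on [-B, B]; the linear term of the chord sums to zero.
  have key : ∀ a ∈ A, Real.exp (y a) ≤ Real.cosh B + y a * (Real.sinh B / B) := fun a ha => by
    have h1 : |y a / B| ≤ 1 := by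
      rw [abs_div, abs_of_pos hB]
      exact (div_le_one hB).2 (hy a ha)
    have h2 := Real.exp_mul_le_cosh_add_mul_sinh h1 B
    rw [div_mul_cancel₀ _ hB.ne'] at h2
    linarith [show y a / B * Real.sinh B = y a * (Real.sinh B / B) by ring]
  calc ∑ a ∈ A, Real.exp (y a) ≤ ∑ a ∈ A, (Real.cosh B + y a * (Real.sinh B / B)) :=
        sum_le_sum key
    _ = #A * Real.cosh B := by rw [sum_add_distrib, ← sum_mul, h0]; simp
    _ ≤ #A * Real.exp (B ^ 2 / 2) := by gcongr; exact Real.cosh_le_exp_half_sq B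

/-- Hoeffding's lemma for the uniform distribution on a finite set, with a shrinking factor. -/
theorem _root_.Finset.sum_exp_mul_sub_mean_le {α : Type*} (A : Finset α) (x : α → ℝ) {b θ : ℝ}
    (hx : ∀ a ∈ A, |x a| ≤ b) (hθ : |θ| ≤ 1) :
    ∑ a ∈ A, Real.exp (θ * (x a - (∑ a ∈ A, x a) / #A)) ≤ #A * Real.exp (2 * b ^ 2) := by
  rcases A.eq_empty_or_nonempty with rfl | hA
  · simp
  have hN : (0 : ℝ) < #A := by exact_mod_cast hA.card_pos
  set μ := (∑ a ∈ A, x a) / #A with hμ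
  have hμb : |μ| ≤ b := by
    rw [hμ, abs_div, abs_of_pos hN, div_le_iff₀ hN]
    calc |∑ a ∈ A, x a| ≤ ∑ a ∈ A, |x a| := abs_sum_le_sum_abs _ _
      _ ≤ ∑ _a ∈ A, b := sum_le_sum hx
      _ = b * #A := by simp [mul_comm]
  have := A.sum_exp_le_of_sum_eq_zero (fun a => θ * (x a - μ)) (2 * b)
    (fun a ha => by
      rw [abs_mul]
      have h1 : |x a - μ| ≤ 2 * b := (abs_sub _ _).trans (by linarith [hx a ha])
      nlinarith [abs_nonneg θ, abs_nonneg (x a - μ)])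
    (by
      rw [← mul_sum, sum_sub_distrib, hμ, sum_const, nsmul_eq_mul, mul_div_cancel₀ _ hN.ne']
      simp)
  refine this.trans (le_of_eq ?_)
  ring_nf

/-- The exponential moment of a sum of independent uniform draws from a finite set. -/
theorem sum_exp_sum_le {α : Type*} [Fintype α] (x : α → ℝ) {b : ℝ} (hx : ∀ a, |x a| ≤ b) (c : ℕ) :
    ∑ s : Fin c → α, Real.exp (∑ k, x (s k)) ≤
      (Fintype.card α : ℝ) ^ c *
        Real.exp (c * ((∑ a, x a) / Fintype.card α) + c * (2 * b ^ 2)) := by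
  classical
  set μ := (∑ a, x a) / Fintype.card α with hμ
  have h1 : ∑ a, Real.exp (x a) ≤ Fintype.card α * Real.exp (μ + 2 * b ^ 2) := by
    have := (univ : Finset α).sum_exp_mul_sub_mean_le x (θ := 1) (fun a _ => hx a) (by simp)
    rw [card_univ, ← hμ] at this
    calc ∑ a, Real.exp (x a) = Real.exp μ * ∑ a, Real.exp (1 * (x a - μ)) := by
          rw [mul_sum]
          refine sum_congr rfl fun a _ => ?_
          rw [← Real.exp_add]
          ring_nf
      _ ≤ Real.exp μ * (Fintype.card α * Real.exp (2 * b ^ 2)) := by gcongr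
      _ = _ := by rw [Real.exp_add]; ring
  calc ∑ s : Fin c → α, Real.exp (∑ k, x (s k)) = (∑ a, Real.exp (x a)) ^ c := by
        simp_rw [Real.exp_sum, Fintype.sum_pow]
    _ ≤ (Fintype.card α * Real.exp (μ + 2 * b ^ 2)) ^ c :=
        pow_le_pow_left₀ (sum_nonneg fun _ _ => (Real.exp_pos _).le) h1 c
    _ = _ := by rw [mul_pow, ← Real.exp_nat_mul]; ring_nf

/-- The exponential moment of a sum of uniform draws from a finite set without replacement. -/
theorem sum_exp_sum_injective_le {α : Type*} [Fintype α] [DecidableEq α] (x : α → ℝ) {b : ℝ}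
    (hx : ∀ a, |x a| ≤ b) (c : ℕ) (A : Finset α) (hc : c ≤ #A) :
    (∑ s : Fin c → α,
      if Function.Injective s ∧ ∀ k, s k ∈ A then Real.exp (∑ k, x (s k)) else 0) ≤
      ((#A).descFactorial c : ℝ) *
        Real.exp (c * ((∑ a ∈ A, x a) / #A) + c * (2 * b ^ 2)) := by
  induction c generalizing A with
  | zero => simp [Function.injective_of_subsingleton]
  | succ c ih =>
    obtain ⟨N, hN⟩ : ∃ N, #A = N + 1 := ⟨#A - 1, by omega⟩
    have hcN : c ≤ N := by omega
    set μ := (∑ a ∈ A, x a) / #A with hμ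
    have hsum : ∑ a ∈ A, x a = (N + 1) * μ := by
      rw [hμ, hN]; push_cast; field_simp
    -- Drawing `a` first moves the mean of the rest to μ - (x a - μ)/N, so the first draw and the
    -- `c` later means add up to (c + 1)μ + θ(x a - μ).
    set θ : ℝ := 1 - c / N with hθ
    have hθ1 : |θ| ≤ 1 := by
      have h1 : (c : ℝ) / N ≤ 1 := div_le_one_of_le₀ (by exact_mod_cast hcN) (by positivity)
      have h2 : (0 : ℝ) ≤ c / N := by positivity
      rw [abs_le]; constructor <;> linarith
    have hsplit : (∑ s : Fin (c + 1) → α,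
        if Function.Injective s ∧ ∀ k, s k ∈ A then Real.exp (∑ k, x (s k)) else 0) =
        ∑ a ∈ A, Real.exp (x a) * ∑ s : Fin c → α,
          if Function.Injective s ∧ ∀ k, s k ∈ A.erase a then Real.exp (∑ k, x (s k)) else 0 := by
      rw [← (Fin.consEquiv fun _ => α).sum_comp, Fintype.sum_prod_type,
        ← sum_filter_add_sum_filter_not univ (· ∈ A)]
      rw [sum_eq_zero (s := univ.filter (· ∉ A)), add_zero]
      · rw [filter_mem_eq_inter, univ_inter]
        refine sum_congr rfl fun a ha => ?_
        rw [mul_sum]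
        refine sum_congr rfl fun s _ => ?_
        have : (Function.Injective ((Fin.consEquiv fun _ => α) (a, s)) ∧
            ∀ k, (Fin.consEquiv fun _ => α) (a, s) k ∈ A) ↔
            (Function.Injective s ∧ ∀ k, s k ∈ A.erase a) := by
          change (Function.Injective (Fin.cons a s : Fin (c + 1) → α) ∧
            ∀ k, (Fin.cons a s : Fin (c + 1) → α) k ∈ A) ↔ _
          simp only [Fin.cons_injective_iff, Fin.forall_fin_succ, Fin.cons_zero, Fin.cons_succ,
            mem_erase, Set.mem_range, not_exists]
          grind
        rw [if_congr this rfl rfl, mul_ite, mul_zero, ← Real.exp_add, Fin.sum_univ_succ]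
        simp [Fin.consEquiv]
      · intro a ha
        refine sum_eq_zero fun s _ => if_neg fun h => ?_
        have := h.2 0
        simp [Fin.consEquiv] at this
        simp [this] at ha
    have hterm : ∀ a ∈ A, Real.exp (x a) * (∑ s : Fin c → α,
          if Function.Injective s ∧ ∀ k, s k ∈ A.erase a then Real.exp (∑ k, x (s k)) else 0) ≤
        (N.descFactorial c * Real.exp ((c + 1) * μ + c * (2 * b ^ 2))) *
          Real.exp (θ * (x a - μ)) := fun a ha => by
      have hcard : #(A.erase a) = N := by rw [card_erase_of_mem ha, hN]; rfl
      have hs : ∑ a ∈ A.erase a, x a = (N + 1) * μ - x a := by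
        rw [← hsum, ← add_sum_erase A x ha]; ring
      have := ih (A.erase a) (by omega)
      rw [hcard, hs] at this
      refine (mul_le_mul_of_nonneg_left this (Real.exp_pos _).le).trans (le_of_eq ?_)
      rw [mul_left_comm, mul_assoc, ← Real.exp_add, ← Real.exp_add]
      congr 2
      rw [hθ]
      rcases Nat.eq_zero_or_pos N with h0 | h0
      · have : c = 0 := by omega
        subst this
        simp
      · have : (N : ℝ) ≠ 0 := by positivity
        field_simp
        ring
    rw [hsplit]
    refine (sum_le_sum hterm).trans ?_
    rw [← mul_sum]
    refine (mul_le_mul_of_nonneg_left (A.sum_exp_mul_sub_mean_le x (fun a _ => hx a) hθ1)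
      (by positivity)).trans (le_of_eq ?_)
    rw [hN, Nat.succ_descFactorial_succ]
    push_cast
    rw [show ((c : ℝ) + 1) * μ + (c + 1) * (2 * b ^ 2) =
      ((c + 1) * μ + c * (2 * b ^ 2)) + 2 * b ^ 2 by ring, Real.exp_add _ (2 * b ^ 2)]
    ring

/-- The tail bound which an exponential moment bound implies for a uniformly random sample from
`Ω`: a function of mean more than `η` has a non-positive sample sum with small probability. -/
theorem card_filter_sum_nonpos_le {α : Type*} {c : ℕ} (Ω : Finset (Fin c → α)) {μ η : ℝ}
    (g : α → ℝ) (hη : 0 ≤ η) (hμ : η ≤ μ)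
    (hΩ : ∑ s ∈ Ω, Real.exp (∑ k, -(η / 4) * g (s k)) ≤
      #Ω * Real.exp (c * (-(η / 4) * μ) + c * (2 * (η / 4) ^ 2))) :
    (#{s ∈ Ω | ∑ k, g (s k) ≤ 0} : ℝ) ≤ #Ω * Real.exp (-(c * η ^ 2 / 8)) := by
  -- Markov's inequality; the rate η/4 minimises -λη + 2λ², with value -η²/8.
  calc (#{s ∈ Ω | ∑ k, g (s k) ≤ 0} : ℝ) = ∑ s ∈ Ω with ∑ k, g (s k) ≤ 0, 1 := by simp
    _ ≤ ∑ s ∈ Ω with ∑ k, g (s k) ≤ 0, Real.exp (∑ k, -(η / 4) * g (s k)) := by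
        refine sum_le_sum fun s hs => ?_
        rw [← mul_sum]
        refine Real.one_le_exp (mul_nonneg_of_nonpos_of_nonpos (by linarith) (mem_filter.1 hs).2)
    _ ≤ ∑ s ∈ Ω, Real.exp (∑ k, -(η / 4) * g (s k)) :=
        sum_le_sum_of_subset_of_nonneg (filter_subset _ _) fun _ _ _ => (Real.exp_pos _).le
    _ ≤ _ := hΩ
    _ ≤ _ := by
        gcongr
        have : (0 : ℝ) ≤ c * (η * (μ - η)) := by
          have := sub_nonneg.2 hμ
          positivity
        nlinarith

theorem card_filter_sum_nonpos_le_of_univ {α : Type*} [Fintype α] (c : ℕ) {η : ℝ}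
    (g : α → ℝ) (hg : ∀ a, |g a| ≤ 1) (hη : 0 ≤ η) (hμ : η ≤ (∑ a, g a) / Fintype.card α) :
    (#{s : Fin c → α | ∑ k, g (s k) ≤ 0} : ℝ) ≤
      #(univ : Finset (Fin c → α)) * Real.exp (-(c * η ^ 2 / 8)) := by
  classical
  refine card_filter_sum_nonpos_le univ g hη hμ ?_
  have := sum_exp_sum_le (fun a => -(η / 4) * g a) (b := η / 4) (fun a => by
    rw [abs_mul, abs_neg, abs_of_nonneg (by positivity)]
    exact mul_le_of_le_one_right (by positivity) (hg a)) c
  rw [← mul_sum, mul_div_assoc] at this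
  simpa using this

theorem card_filter_sum_nonpos_le_of_injective {α : Type*} [Fintype α] [DecidableEq α] {c : ℕ}
    (hc : c ≤ Fintype.card α) {η : ℝ}
    (g : α → ℝ) (hg : ∀ a, |g a| ≤ 1) (hη : 0 ≤ η) (hμ : η ≤ (∑ a, g a) / Fintype.card α) :
    (#{s ∈ {s : Fin c → α | Function.Injective s} | ∑ k, g (s k) ≤ 0} : ℝ) ≤
      #{s : Fin c → α | Function.Injective s} * Real.exp (-(c * η ^ 2 / 8)) := by
  refine card_filter_sum_nonpos_le _ g hη hμ ?_
  have := sum_exp_sum_injective_le (fun a => -(η / 4) * g a) (b := η / 4) (fun a => by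
    rw [abs_mul, abs_neg, abs_of_nonneg (by positivity)]
    exact mul_le_of_le_one_right (by positivity) (hg a)) c univ hc
  rw [← mul_sum, mul_div_assoc] at this
  have hcard : #{s : Fin c → α | Function.Injective s} = (Fintype.card α).descFactorial c := by
    rw [← Fintype.card_subtype,
      Fintype.card_congr (Equiv.subtypeInjectiveEquivEmbedding (Fin c) α),
      Fintype.card_embedding_eq, Fintype.card_fin]
  rw [sum_filter, hcard]
  simpa using this

/-! ### Plurality veto -/

/-- The indicator that `σ` puts an element of `T` first, minus the indicator that `σ` places `w`
weakly above some element of `T`. -/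
noncomputable def gap {m : ℕ} [NeZero m] (w : Fin m) (T : Finset (Fin m)) (σ : Ranking m) : ℝ :=
  (if σ.symm 0 ∈ T then 1 else 0) - (if ∃ t ∈ T, σ w ≤ σ t then 1 else 0)

theorem abs_gap_le_one {m : ℕ} [NeZero m] (w : Fin m) (T : Finset (Fin m)) (σ : Ranking m) :
    |gap w T σ| ≤ 1 := by
  unfold gap
  split_ifs <;> norm_num

/-- Voters veto, one after the other, their least preferred candidate with a positive remaining
score; the last candidate with a positive score wins. -/
theorem exists_veto_winner {m : ℕ} (S : Multiset (Ranking m)) :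
    ∀ s : Fin m → ℕ, S ≠ 0 → ∑ t, s t = S.card → ∃ w, 0 < s w ∧ ∀ T : Finset (Fin m),
      ∑ t ∈ T, s t ≤ (S.map fun σ => if ∃ t ∈ T, σ w ≤ σ t then 1 else 0).sum := by
  induction S using Multiset.induction with
  | empty => exact fun _ h => absurd rfl h
  | cons σ S ih =>
    intro s _ hs
    rw [Multiset.card_cons] at hs
    obtain ⟨v, hv, hmax⟩ : ∃ v, 0 < s v ∧ ∀ w, 0 < s w → σ w ≤ σ v := by
      have hne : (univ.filter fun t => 0 < s t).Nonempty := by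
        by_contra h
        rw [not_nonempty_iff_eq_empty, filter_eq_empty_iff] at h
        have : ∑ t, s t = 0 := sum_eq_zero fun t ht => by simpa using h ht
        omega
      obtain ⟨v, hv, h⟩ := exists_max_image _ σ hne
      exact ⟨v, (mem_filter.1 hv).2, fun w hw => h w (mem_filter.2 ⟨mem_univ _, hw⟩)⟩
    set s' : Fin m → ℕ := fun t => s t - if t = v then 1 else 0 with hs'
    have hss : ∀ t, s t = s' t + if t = v then 1 else 0 := fun t => by
      simp only [hs']
      split_ifs with h
      · subst h; omega
      · simp
    have hsum : ∀ T : Finset (Fin m), ∑ t ∈ T, s t = ∑ t ∈ T, s' t + if v ∈ T then 1 else 0 :=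
      fun T => by
        rw [sum_congr rfl fun t _ => hss t, sum_add_distrib, sum_ite_eq']
    have hs'sum : ∑ t, s' t = S.card := by
      have := hsum univ
      rw [if_pos (mem_univ v)] at this
      omega
    -- The winner for the reduced scores still has a positive score before the veto of `σ`, so `σ`
    -- ranks it weakly above `v`. If no voter remains, `v` itself wins.
    obtain ⟨w, hw, hT⟩ : ∃ w, 0 < s w ∧ ∀ T : Finset (Fin m),
        ∑ t ∈ T, s' t ≤ (S.map fun σ => if ∃ t ∈ T, σ w ≤ σ t then 1 else 0).sum := by
      rcases eq_or_ne S 0 with rfl | hS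
      · refine ⟨v, hv, fun T => ?_⟩
        exact (sum_le_sum_of_subset (subset_univ T)).trans (hs'sum.le.trans (by simp))
      · obtain ⟨w, hw, h⟩ := ih s' hS hs'sum
        exact ⟨w, hw.trans_le (Nat.sub_le _ _), h⟩
    refine ⟨w, hw, fun T => ?_⟩
    rw [hsum, Multiset.map_cons, Multiset.sum_cons, add_comm]
    refine add_le_add ?_ (hT T)
    split_ifs with h1 h2
    · exact le_rfl
    · exact absurd ⟨v, h1, hmax w hw⟩ h2
    · exact zero_le_one
    · exact le_rfl

/-- The initial scores are the plurality scores, which sum to the number of voters. The condition `S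
≠ 0` sits inside the existential so that the mechanism is also defined on the empty collection. -/
theorem exists_forall_sum_gap_nonpos {m : ℕ} [NeZero m] (S : Multiset (Ranking m)) :
    ∃ w, S ≠ 0 → ∀ T, (S.map (gap w T)).sum ≤ 0 := by
  by_cases hS : S = 0
  · exact ⟨0, fun h => absurd hS h⟩
  have hcount : ∀ T : Finset (Fin m), ∑ t ∈ T, (S.map fun σ => σ.symm 0).count t =
      (S.map fun σ => if σ.symm 0 ∈ T then 1 else 0).sum := fun T => by
    induction S using Multiset.induction with
    | empty => simp
    | cons σ S ih =>
      rcases eq_or_ne S 0 with rfl | h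
      · simp [Multiset.count_singleton]
      · simp [Multiset.count_cons, sum_add_distrib, ih h, add_comm]
  obtain ⟨w, -, hw⟩ := exists_veto_winner S (fun t => (S.map fun σ => σ.symm 0).count t) hS (by
    rw [hcount]; simp)
  refine ⟨w, fun _ T => ?_⟩
  have h := hw T
  rw [hcount] at h
  unfold gap
  rw [Multiset.sum_map_sub, sub_nonpos]
  have h' := (Nat.cast_le (α := ℝ)).2 h
  simpa [Nat.cast_multiset_sum, Multiset.map_map, Function.comp_def] using h'

/-- The mechanism that selects the winner of plurality veto. -/
noncomputable def pluralityVeto (m : ℕ) [NeZero m] : Mechanism m :=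
  fun S => (exists_forall_sum_gap_nonpos S).choose

theorem sum_gap_pluralityVeto_nonpos {m : ℕ} [NeZero m] {S : Multiset (Ranking m)} (hS : S ≠ 0)
    (T : Finset (Fin m)) : (S.map (gap (pluralityVeto m S) T)).sum ≤ 0 :=
  (exists_forall_sum_gap_nonpos S).choose_spec hS T

/-! ### From gaps to matchings and distortion -/

/-- A candidate all of whose gaps are small has an almost perfect matching of voters `j` to voters
who weakly prefer it to the top candidate of `j`. -/
theorem exists_injective_of_sum_gap_le {n m : ℕ} [NeZero m] (P : Profile n m) (w : Fin m)
    (D : ℕ) (h : ∀ T, ∑ i, gap w T (P i) < D + 1) :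
    ∃ φ : Fin n → Fin n ⊕ Fin D, Function.Injective φ ∧
      ∀ j i, φ j = Sum.inl i → P i w ≤ P i ((P j).symm 0) := by
  classical
  -- The `D` dummy vertices, adjacent to every voter, make up the deficiency in Hall's condition.
  let N : Fin n → Finset (Fin n ⊕ Fin D) := fun j =>
    (univ.filter fun i => P i w ≤ P i ((P j).symm 0)).disjSum univ
  have hall : ∀ S : Finset (Fin n), #S ≤ #(S.biUnion N) := by
    intro S
    rcases S.eq_empty_or_nonempty with rfl | ⟨j₀, hj₀⟩
    · simp
    -- For the set `T` of top candidates of `S`, the real neighbours of `S` are exactly the voters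
    -- counted negatively in `gap w T`.
    set T : Finset (Fin m) := S.image fun j => (P j).symm 0 with hT
    have h1 : #S ≤ #{i | (P i).symm 0 ∈ T} :=
      card_le_card fun j hj =>
        mem_filter.2 ⟨mem_univ _, mem_image_of_mem (fun j => (P j).symm 0) hj⟩
    have h2 : (univ.filter fun i => ∃ t ∈ T, P i w ≤ P i t).disjSum univ ⊆ S.biUnion N := by
      rintro (i | d) hx
      · simp only [inl_mem_disjSum, mem_filter, mem_univ, true_and, hT, mem_image] at hx
        obtain ⟨_, ⟨j, hj, rfl⟩, hx⟩ := hx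
        exact mem_biUnion.2 ⟨j, hj, by simpa [N] using hx⟩
      · exact mem_biUnion.2 ⟨j₀, hj₀, by simp [N]⟩
    have h3 := card_le_card h2
    rw [card_disjSum, card_univ, Fintype.card_fin] at h3
    have h4 := h T
    unfold gap at h4
    rw [sum_sub_distrib, sum_boole, sum_boole] at h4
    have h5 : #{i | (P i).symm 0 ∈ T} < D + 1 + #{i | ∃ t ∈ T, P i w ≤ P i t} := by
      exact_mod_cast sub_lt_iff_lt_add.1 h4
    omega
  obtain ⟨φ, hφ, hmem⟩ := (all_card_le_biUnion_card_iff_exists_injective N).1 hall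
  refine ⟨φ, hφ, fun j i hji => ?_⟩
  have := hmem j
  rw [hji] at this
  simpa [N] using this

theorem Consistent.dist_le {n m : ℕ} {P : Profile n m} {M : Type u} [MetricSpace M]
    {v : Fin n → M} {c : Fin m → M} (h : Consistent P v c) {i : Fin n} {a b : Fin m}
    (hab : P i a ≤ P i b) : dist (v i) (c a) ≤ dist (v i) (c b) := by
  rcases hab.lt_or_eq with hab | hab
  · exact h i a b hab
  · rw [(P i).injective hab]

/-- Through the top candidate of j, the partner ψ j is within d(ψ j, o) + 2 d(j, o) of w; summing
gives the 3. Each of the at most `D` voters outside the image of ψ pays the detour d(o, w), which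
averaging over the matched pairs bounds. -/
theorem socialCost_le_of_injective {n m : ℕ} [NeZero m] {P : Profile n m} {M : Type u}
    [MetricSpace M] {v : Fin n → M} {c : Fin m → M} (h : Consistent P v c) {w : Fin m} {D : ℕ}
    {η : ℝ} (hD : D ≤ η * n) (hη : η ≤ 1 / 2)
    (φ : Fin n → Fin n ⊕ Fin D) (hφ : Function.Injective φ)
    (hφw : ∀ j i, φ j = Sum.inl i → P i w ≤ P i ((P j).symm 0)) (o : Fin m) :
    socialCost v c w ≤ (3 + 8 * η) * socialCost v c o := by
  classical
  set d : Fin n → ℝ := fun i => dist (v i) (c o) with hd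
  set S := socialCost v c o with hS
  have hSd : ∑ i, d i = S := rfl
  have hd0 : ∀ i, 0 ≤ d i := fun i => dist_nonneg
  set J : Finset (Fin n) := univ.filter fun j => ∃ i, φ j = Sum.inl i with hJ
  choose! ψ hψ using fun (j : Fin n) (hj : ∃ i, φ j = Sum.inl i) => hj
  have hJψ : ∀ j ∈ J, φ j = Sum.inl (ψ j) := fun j hj => hψ j (mem_filter.1 hj).2
  have hinj : Set.InjOn ψ J := fun j hj k hk hjk => hφ (by rw [hJψ j hj, hJψ k hk, hjk])
  have hJc : #(univ \ J) ≤ D := by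
    have : #((univ \ J).image φ) ≤ #((univ : Finset (Fin D)).image Sum.inr) :=
      card_le_card fun x hx => by
        obtain ⟨j, hj, rfl⟩ := mem_image.1 hx
        rcases hx' : φ j with i | e
        · simp [hJ, hx'] at hj
        · simp
    rw [card_image_of_injective _ hφ] at this
    exact this.trans (card_image_le.trans (by simp))
  have hJcard : (n : ℝ) - D ≤ #J := by
    have := card_sdiff_add_card_eq_card (subset_univ J)
    rw [card_univ, Fintype.card_fin] at this
    have h2 : n ≤ D + #J := by omega
    have h3 : (n : ℝ) ≤ D + #J := by exact_mod_cast h2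
    linarith
  have hpair : ∀ j ∈ J, dist (v (ψ j)) (c w) ≤ d (ψ j) + 2 * d j := fun j hj => by
    set a := (P j).symm 0 with ha
    have h1 : dist (v (ψ j)) (c w) ≤ dist (v (ψ j)) (c a) := h.dist_le (hφw j _ (hJψ j hj))
    have h2 : dist (v j) (c a) ≤ dist (v j) (c o) := h.dist_le (by simp [ha])
    have h3 := dist_triangle4 (v (ψ j)) (c o) (v j) (c a)
    rw [dist_comm (c o) (v j)] at h3
    simp only [hd]
    linarith
  have hwo : ∀ i, dist (v i) (c w) ≤ d i + dist (c o) (c w) := fun i => dist_triangle _ _ _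
  have hsumψ : ∑ j ∈ J, d (ψ j) = ∑ i ∈ J.image ψ, d i := (sum_image hinj).symm
  have hsumJ : ∑ j ∈ J, d j ≤ S :=
    sum_le_sum_of_subset_of_nonneg (subset_univ _) fun i _ _ => hd0 i
  have hsumI : ∑ i ∈ J.image ψ, d i ≤ S :=
    sum_le_sum_of_subset_of_nonneg (subset_univ _) fun i _ _ => hd0 i
  have hx : (#J : ℝ) * dist (c o) (c w) ≤ 4 * S := by
    calc (#J : ℝ) * dist (c o) (c w) = ∑ _j ∈ J, dist (c o) (c w) := by simp
      _ ≤ ∑ j ∈ J, (2 * d (ψ j) + 2 * d j) := sum_le_sum fun j hj => by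
          have h1 := hpair j hj
          have h2 := dist_triangle_left (c o) (c w) (v (ψ j))
          simp only [hd] at h1 ⊢
          linarith
      _ = 2 * ∑ j ∈ J, d (ψ j) + 2 * ∑ j ∈ J, d j := by rw [sum_add_distrib, mul_sum, mul_sum]
      _ ≤ 4 * S := by rw [hsumψ]; linarith
  have hDx : (D : ℝ) * dist (c o) (c w) ≤ 8 * η * S := by
    have h0 : 0 ≤ dist (c o) (c w) := dist_nonneg
    have hS0 : 0 ≤ S := hSd ▸ sum_nonneg fun i _ => hd0 i
    rcases Nat.eq_zero_or_pos n with rfl | hn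
    · have : S = 0 := by rw [← hSd]; simp
      have hD0 : (D : ℝ) ≤ 0 := by simpa using hD
      rw [this]
      nlinarith
    have hn' : (0 : ℝ) < n := by exact_mod_cast hn
    have hη0 : 0 ≤ η := by
      by_contra hneg
      have : (0 : ℝ) ≤ D := by positivity
      nlinarith
    -- At least n - D ≥ n/2 voters are matched, because η ≤ 1/2.
    have h1 : (n : ℝ) / 2 * dist (c o) (c w) ≤ 4 * S :=
      (mul_le_mul_of_nonneg_right (by nlinarith) h0).trans hx
    calc (D : ℝ) * dist (c o) (c w) ≤ η * n * dist (c o) (c w) :=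
          mul_le_mul_of_nonneg_right hD h0
      _ = 2 * η * ((n : ℝ) / 2 * dist (c o) (c w)) := by ring
      _ ≤ 2 * η * (4 * S) := mul_le_mul_of_nonneg_left h1 (by positivity)
      _ = _ := by ring
  have hI : ∑ i ∈ J.image ψ, dist (v i) (c w) ≤ ∑ i ∈ J.image ψ, d i + 2 * S := by
    rw [sum_image hinj, ← hsumψ]
    refine (sum_le_sum hpair).trans ?_
    rw [sum_add_distrib, ← mul_sum]
    linarith
  have hIc : ∑ i ∈ univ \ J.image ψ, dist (v i) (c w) ≤
      ∑ i ∈ univ \ J.image ψ, d i + D * dist (c o) (c w) := by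
    refine (sum_le_sum fun i _ => hwo i).trans ?_
    rw [sum_add_distrib, sum_const, nsmul_eq_mul]
    have hc : #(univ \ J.image ψ) ≤ D := by
      have h1 := card_sdiff_add_card_eq_card (subset_univ J)
      have h2 := card_sdiff_add_card_eq_card (subset_univ (J.image ψ))
      rw [card_image_of_injOn hinj] at h2
      omega
    have : (#(univ \ J.image ψ) : ℝ) ≤ D := by exact_mod_cast hc
    gcongr
  have hsplit := sum_sdiff (f := d) (subset_univ (J.image ψ))
  rw [hSd] at hsplit
  unfold socialCost
  rw [← sum_sdiff (subset_univ (J.image ψ))]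
  linarith

theorem distortion_le_of_sum_gap_le {n m : ℕ} [NeZero m] (P : Profile n m) (w : Fin m) {η : ℝ}
    (hη0 : 0 ≤ η) (hη : η ≤ 1 / 2) (h : ∀ T, ∑ i, gap w T (P i) ≤ η * n) :
    distortion.{u} P w ≤ ENNReal.ofReal (3 + 8 * η) := by
  have hηn : 0 ≤ η * n := by positivity
  obtain ⟨φ, hφ, hφw⟩ := exists_injective_of_sum_gap_le P w ⌊η * n⌋₊ fun T =>
    (h T).trans_lt (Nat.lt_floor_add_one _)
  refine iSup_le fun M => iSup_le fun _ => iSup_le fun v => iSup_le fun c => iSup_le fun hc => ?_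
  -- The product form also covers optimal cost 0, where it forces the cost of `w` to vanish.
  refine ENNReal.div_le_of_le_mul ?_
  rw [← ENNReal.ofReal_mul (by linarith)]
  refine ENNReal.ofReal_le_ofReal ?_
  obtain ⟨o, ho⟩ := exists_eq_ciInf_of_finite (f := fun a => socialCost v c a)
  rw [← ho]
  exact socialCost_le_of_injective hc (Nat.floor_le hηn) hη φ hφ hφw o

/-! ### Union bound and choice of the sample size -/

theorem ofReal_one_sub_le_uniformOn {α : Type*} [MeasurableSpace α]
    [MeasurableSingletonClass α] [DecidableEq α] {Ω B : Finset α} {G : Set α} {δ : ℝ} (hΩ : Ω.Nonempty)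
    (hB : (#B : ℝ) ≤ δ * #Ω) (hG : ∀ s ∈ Ω, s ∉ B → s ∈ G) :
    ENNReal.ofReal (1 - δ) ≤ ProbabilityTheory.uniformOn (Ω : Set α) G := by
  have hsub : ((Ω \ B : Finset α) : Set α) ⊆ G := fun s hs => by
    have := mem_sdiff.1 (mem_coe.1 hs)
    exact hG s this.1 this.2
  refine le_trans ?_ (MeasureTheory.measure_mono hsub)
  have hpos : (0 : ℝ) < #Ω := by exact_mod_cast hΩ.card_pos
  rw [ProbabilityTheory.uniformOn_apply_finset, inter_eq_right.2 sdiff_subset,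
    ← ENNReal.ofReal_natCast, ← ENNReal.ofReal_natCast, ← ENNReal.ofReal_div_of_pos hpos]
  refine ENNReal.ofReal_le_ofReal ?_
  rw [le_div_iff₀ hpos]
  have : (#Ω : ℝ) ≤ #(Ω \ B) + #B := by
    exact_mod_cast card_le_card_sdiff_add_card
  linarith

/-- The sampling scheme enters only through the tail bound `hΩ`, so one union bound serves both
schemes. -/
theorem ofReal_one_sub_le_uniformOn_goodSamples {n m c : ℕ} [NeZero m] (P : Profile n m)
    (hc : c ≠ 0) {η δ : ℝ} (hη0 : 0 < η) (hη : η ≤ 1 / 2) (hδ : 0 < δ)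
    (hcη : (m : ℝ) + Real.log (m / δ) ≤ c * η ^ 2 / 8)
    {Ω : Finset (Fin c → Fin n)} (hΩne : Ω.Nonempty)
    (hΩ : ∀ g : Fin n → ℝ, (∀ i, |g i| ≤ 1) → η ≤ (∑ i, g i) / n →
      (#{s ∈ Ω | ∑ k, g (s k) ≤ 0} : ℝ) ≤ #Ω * Real.exp (-(c * η ^ 2 / 8))) :
    ENNReal.ofReal (1 - δ) ≤ ProbabilityTheory.uniformOn (Ω : Set (Fin c → Fin n))
      (goodSamples.{u} c P (pluralityVeto m) (3 + 8 * η)) := by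
  classical
  have : NeZero c := ⟨hc⟩
  have hn : 0 < n := by
    obtain ⟨s, -⟩ := hΩne
    exact Fin.pos (s 0)
  have hn' : (0 : ℝ) < n := by exact_mod_cast hn
  have hm : (0 : ℝ) < m := by exact_mod_cast NeZero.pos m
  let E : Finset (Fin m × Finset (Fin m)) := univ.filter fun p => η * n < ∑ i, gap p.1 p.2 (P i)
  let B : Finset (Fin c → Fin n) :=
    E.biUnion fun p => Ω.filter fun s => ∑ k, gap p.1 p.2 (P (s k)) ≤ 0
  refine ofReal_one_sub_le_uniformOn (B := B) hΩne ?_ ?_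
  · calc (#B : ℝ) ≤ ∑ p ∈ E, (#{s ∈ Ω | ∑ k, gap p.1 p.2 (P (s k)) ≤ 0} : ℝ) := by
          exact_mod_cast card_biUnion_le
      _ ≤ ∑ _p ∈ E, #Ω * Real.exp (-(c * η ^ 2 / 8)) := sum_le_sum fun p hp =>
          hΩ (fun i => gap p.1 p.2 (P i)) (fun i => abs_gap_le_one _ _ _)
            ((le_div_iff₀ hn').2 (mem_filter.1 hp).2.le)
      _ ≤ (m * 2 ^ m) * (#Ω * Real.exp (-(c * η ^ 2 / 8))) := by
          rw [sum_const, nsmul_eq_mul]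
          gcongr
          have : #E ≤ m * 2 ^ m := (card_le_univ E).trans (by simp)
          exact_mod_cast this
      -- The term `m` of the sample size pays for the 2^m sets, and log(m/δ) for the m candidates
      -- and for δ.
      _ ≤ (m * Real.exp m) * (#Ω * Real.exp (-(m + Real.log (m / δ)))) := by
          gcongr
          calc (2 : ℝ) ^ m ≤ Real.exp 1 ^ m := by
                gcongr
                linarith [Real.add_one_le_exp (1 : ℝ)]
            _ = Real.exp m := by rw [← Real.exp_nat_mul, mul_one]
      _ = δ * #Ω := by
          rw [neg_add, Real.exp_add, Real.exp_neg, Real.exp_neg, Real.exp_log (by positivity)]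
          field_simp
  · intro s hs hsB
    refine distortion_le_of_sum_gap_le P _ hη0.le hη fun T => ?_
    by_contra hlt
    refine hsB (mem_biUnion.2 ⟨(pluralityVeto m (sampledRankings P s), T),
      mem_filter.2 ⟨mem_univ _, not_le.1 hlt⟩, mem_filter.2 ⟨hs, ?_⟩⟩)
    have hne : sampledRankings P s ≠ 0 := by
      rw [← Multiset.card_pos, sampledRankings]
      simpa using Nat.pos_of_ne_zero hc
    have := sum_gap_pluralityVeto_nonpos hne T
    conv at this => enter [1, 1, 2]; rw [sampledRankings]
    rwa [Multiset.map_map] at this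

/-- The plurality veto winner of a large sample has distortion at most `3 + ε` with high
probability, for sampling with and without replacement. -/
theorem pluralityVeto_sampling {m c : ℕ} [NeZero m] {ε δ : ℝ} (hε0 : 0 < ε)
    (hε : ε ≤ 4) (hδ0 : 0 < δ) (hc : 512 * (((m : ℝ) + Real.log ((m : ℝ) / δ)) / ε ^ 2) ≤ c)
    (hc0 : c ≠ 0) {n : ℕ} (P : Profile n m) (hn : 1 ≤ n) :
    ENNReal.ofReal (1 - δ) ≤
        withReplacement c n (goodSamples.{u} c P (pluralityVeto m) (3 + ε)) ∧
      (c ≤ n → ENNReal.ofReal (1 - δ) ≤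
        withoutReplacement c n (goodSamples.{u} c P (pluralityVeto m) (3 + ε))) := by
  have hη0 : 0 < ε / 8 := by positivity
  have hη : ε / 8 ≤ 1 / 2 := by linarith
  have hcη : (m : ℝ) + Real.log (m / δ) ≤ c * (ε / 8) ^ 2 / 8 := by
    rw [← mul_div_assoc, div_le_iff₀ (by positivity)] at hc
    linarith
  have hε8 : 3 + ε = 3 + 8 * (ε / 8) := by ring
  have : NeZero n := ⟨by omega⟩
  rw [hε8]
  constructor
  · have := ofReal_one_sub_le_uniformOn_goodSamples.{u} (Ω := univ) P hc0 hη0 hη hδ0 hcη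
      univ_nonempty fun g hg hμ =>
        card_filter_sum_nonpos_le_of_univ c g hg hη0.le (by rwa [Fintype.card_fin])
    rwa [coe_univ] at this
  · intro hcn
    have := ofReal_one_sub_le_uniformOn_goodSamples.{u}
      (Ω := univ.filter fun s : Fin c → Fin n => Function.Injective s) P hc0 hη0 hη hδ0 hcη
      ⟨Fin.castLE hcn, mem_filter.2 ⟨mem_univ _, Fin.castLE_injective hcn⟩⟩ fun g hg hμ =>
        card_filter_sum_nonpos_le_of_injective (by rwa [Fintype.card_fin]) g hg hη0.le
          (by rwa [Fintype.card_fin])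
    rwa [coe_filter_univ] at this

end MetricVoting

theorem mainTheorem3 :
    ∃ k₁ k₂ : ℝ, 0 < k₁ ∧ 0 < k₂ ∧
      ∀ (m : ℕ) (ε δ : ℝ), 1 ≤ m → 0 < ε → ε ≤ 4 → 0 < δ → δ < 1 →
        ∃ (c : ℕ) (f : MetricVoting.Mechanism m),
          k₁ * (((m : ℝ) + Real.log ((m : ℝ) / δ)) / ε ^ 2) ≤ (c : ℝ) ∧
          (c : ℝ) ≤ k₂ * (((m : ℝ) + Real.log ((m : ℝ) / δ)) / ε ^ 2) ∧
          ∀ (n : ℕ) (P : MetricVoting.Profile n m), 1 ≤ n →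
            ENNReal.ofReal (1 - δ) ≤
              MetricVoting.withReplacement c n
                (MetricVoting.goodSamples.{u} c P f (3 + ε)) ∧
            (c ≤ n →
              ENNReal.ofReal (1 - δ) ≤
                MetricVoting.withoutReplacement c n
                  (MetricVoting.goodSamples.{u} c P f (3 + ε))) := by
  -- 512 = 8·8² comes from η = ε/8 in the exponent cη²/8. Rounding up adds less than 1 ≤ 16X, as ε²
  -- ≤ 16, hence 528 = 512 + 16.
  refine ⟨512, 528, by norm_num, by norm_num, fun m ε δ hm hε0 hε hδ0 hδ => ?_⟩
  have : NeZero m := ⟨by omega⟩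
  have hm' : (1 : ℝ) ≤ m := by exact_mod_cast hm
  set X := ((m : ℝ) + Real.log ((m : ℝ) / δ)) / ε ^ 2 with hX
  have hX16 : 1 ≤ 16 * X := by
    have hlog : 0 ≤ Real.log ((m : ℝ) / δ) :=
      Real.log_nonneg ((one_le_div hδ0).2 (hδ.le.trans hm'))
    rw [hX, ← mul_div_assoc, one_le_div (by positivity)]
    nlinarith
  have hc := Nat.le_ceil (512 * X)
  have hc0 : ⌈512 * X⌉₊ ≠ 0 := (Nat.ceil_pos.2 (by linarith)).ne'
  refine ⟨⌈512 * X⌉₊, MetricVoting.pluralityVeto m, hc, ?_, fun n P hn =>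
    MetricVoting.pluralityVeto_sampling hε0 hε hδ0 hc hc0 P hn⟩
  linarith [Nat.ceil_lt_add_one (show 0 ≤ 512 * X by linarith)]
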